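/- All graphs are finite and simple. A Halin graph is a planar graph $G$ that is obtained from a tree $T$ by adding the edges of a cycle whose vertices are exactly the leaves of $T$ (so $T$ has at least three leaves; vertices of degree two in $T$ are allowed). Here a graph is planar if it can be drawn in the plane with its vertices as distinct points and its edges as simple arcs that meet only at common ends. A feedback vertex set of $G$ is a set $S$ of vertices such that $G\setminus S$ is a forest, and $\mathrm{fvs}(G)$ is the minimum size of a feedback vertex set of $G$. A cycle packing of $G$ is a set of pairwise vertex-disjoint cycles that are subgraphs of $G$, and $\mathrm{cp}(G)$ is the maximum size of a cycle packing of $G$. Corollary. Every Halin graph $G$ satisfies $$\mathrm{fvs}(G) \le 2\cdot \mathrm{cp}(G).$$ -/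

import Mathlib

namespace JonesHalin

/-- The Euclidean plane. -/
abbrev Plane : Type := EuclideanSpace ℝ (Fin 2)

/-- A simple graph is planar if it can be drawn in the plane without crossings: the vertices are
distinct points, every edge is a simple arc joining its two ends and passing through no other
vertex, and two different edges meet at most in common ends. -/
def IsPlanar {V : Type*} (G : SimpleGraph V) : Prop :=
  ∃ (point : V → Plane) (curve : Sym2 V → Set Plane),
    Function.Injective point ∧
    (∀ u v : V, G.Adj u v →
      ∃ γ : Path (point u) (point v), Function.Injective γ ∧ Set.range γ = curve s(u, v)) ∧
    (∀ e ∈ G.edgeSet, ∀ w : V, point w ∈ curve e → w ∈ e) ∧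
    (∀ e ∈ G.edgeSet, ∀ e' ∈ G.edgeSet, e ≠ e' →
      curve e ∩ curve e' ⊆ point '' {w : V | w ∈ e ∧ w ∈ e'})

/-- A leaf of a graph is a vertex with exactly one neighbour. -/
def IsLeaf {V : Type*} (T : SimpleGraph V) (v : V) : Prop :=
  ∃! w : V, T.Adj v w

/-- A Halin graph is a planar graph that is obtained from a tree `T` by adding the edges of a
cycle whose vertices are exactly the leaves of `T`. -/
def IsHalin {V : Type*} (G : SimpleGraph V) : Prop :=
  IsPlanar G ∧
    ∃ T : SimpleGraph V, T.IsTree ∧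
      ∃ (u : V) (c : (⊤ : SimpleGraph V).Walk u u), c.IsCycle ∧
        (∀ v : V, v ∈ c.support ↔ IsLeaf T v) ∧
        G = T ⊔ SimpleGraph.fromEdgeSet {e | e ∈ c.edges}

/-- A feedback vertex set: a set of vertices whose deletion leaves a forest. -/
def IsFeedbackVertexSet {V : Type*} (G : SimpleGraph V) (S : Set V) : Prop :=
  (G.induce Sᶜ).IsAcyclic

/-- `fvs G` is the minimum size of a feedback vertex set of `G`. -/
noncomputable def fvs {V : Type*} (G : SimpleGraph V) : ℕ∞ :=
  ⨅ (S : Set V) (_ : IsFeedbackVertexSet G S), S.encard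

/-- The subgraphs of `G` that are cycles. -/
def IsCycleSubgraph {V : Type*} {G : SimpleGraph V} (H : G.Subgraph) : Prop :=
  ∃ (u : V) (c : G.Walk u u), c.IsCycle ∧ c.toSubgraph = H

/-- A cycle packing of `G`: a set of pairwise vertex-disjoint cycles of `G`. -/
def IsCyclePacking {V : Type*} (G : SimpleGraph V) (P : Set G.Subgraph) : Prop :=
  (∀ H ∈ P, IsCycleSubgraph H) ∧ P.Pairwise fun H K => Disjoint H.verts K.verts

/-- `cp G` is the maximum size of a cycle packing of `G`. -/
noncomputable def cp {V : Type*} (G : SimpleGraph V) : ℕ∞ :=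
  ⨆ (P : Set G.Subgraph) (_ : IsCyclePacking G P), P.encard

end JonesHalin

/-! Call the edges of the cycle through the leaves rim edges. Each rim edge closes a fundamental
cycle with the path of `T` between its ends, and vertex-disjoint paths give vertex-disjoint cycles.
Paths in a tree have the Kőnig property (`exists_hitting_set_of_paths`): there is a vertex set `X`
meeting the tree paths of all rim edges, together with a rim edge `e v` for each `v ∈ X` whose tree
path contains `v`, these paths being pairwise disjoint. Hence `cp G` is at least the size of `X`.

Deleting `X` and one end of each edge `e v` leaves a forest (`isFeedbackVertexSet`), which gives the
factor 2. A surviving cycle would use some rim edge, whose tree path is hit by some `v ∈ X`. That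
edge and `e v` split the rim into two arcs, and by `between_of_mem_arc` no component of `T - v` has
leaves in both arcs. So, in `G - v`, only these two rim edges join the two sides, and `e v` has lost
an end: the cycle would cross a cut exactly once.

Planarity enters through `not_crossing`, where a violation produces a subdivided `K₃,₃`. That `K₃,₃`
cannot be drawn is proved by a parity count of increments of continuous logarithms. -/

namespace JonesHalin

/-! ### Continuous logarithms and `K₃,₃` in the plane -/

section
open Complex

/-- Two continuous logarithms of the same function have the same increments. -/
theorem sub_eq_sub_of_exp_eq {f g : ℝ → ℂ} (hf : Continuous f) (hg : Continuous g)
    (h : ∀ t, exp (f t) = exp (g t)) (s t : ℝ) : f s - f t = g s - g t := by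
  have hc : (fun t => g t + (f s - g s)) = f := by
    refine isCoveringMap_exp.eq_of_comp_eq (by fun_prop) hf (funext fun t => Subtype.ext ?_) s
      (by simp)
    simp only [Function.comp_apply]
    rw [exp_add, exp_sub, h s, div_self (exp_ne_zero _), mul_one, h t]
  rw [← congr_fun hc t]
  ring

theorem exists_continuous_log {F : ℝ × ℝ → ℂ} (hF : Continuous F) (h0 : ∀ p, F p ≠ 0) :
    ∃ L : ℝ × ℝ → ℂ, Continuous L ∧ ∀ p, exp (L p) = F p := by
  obtain ⟨L, ⟨-, hL⟩, -⟩ := isCoveringMapOn_exp.existsUnique_continuousMap_lifts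
    (⟨F, hF⟩ : C(ℝ × ℝ, ℂ)) (a₀ := 0) (exp_log (h0 0)) (fun p => h0 p)
  exact ⟨L, L.continuous, fun p => congr_fun hL p⟩

/-- An increment along `γ` of a continuous logarithm of `γ - p`. -/
def IsLogIncrement {u v : ℂ} (γ : Path u v) (p θ : ℂ) : Prop :=
  ∃ L : ℝ → ℂ, Continuous L ∧ (∀ t, exp (L t) = γ.extend t - p) ∧ L 1 - L 0 = θ

theorem IsLogIncrement.unique {u v p θ θ' : ℂ} {γ : Path u v} (h : IsLogIncrement γ p θ)
    (h' : IsLogIncrement γ p θ') : θ = θ' := by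
  obtain ⟨L, hL, hexp, rfl⟩ := h
  obtain ⟨L', hL', hexp', rfl⟩ := h'
  exact sub_eq_sub_of_exp_eq hL hL' (fun t => by rw [hexp, hexp']) 1 0

theorem IsLogIncrement.exp_mul {u v p θ : ℂ} {γ : Path u v} (h : IsLogIncrement γ p θ) :
    exp θ * (u - p) = v - p := by
  obtain ⟨L, hL, hexp, rfl⟩ := h
  have h0 := hexp 0
  have h1 := hexp 1
  simp only [Path.extend_zero, Path.extend_one] at h0 h1
  rw [← h0, ← h1, ← exp_add]
  congr 1; ring

/-- The difference of the two curves never vanishes, so it has a continuous logarithm in both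
parameters; the relation compares its increments along the two ways around the unit square. Adding
`π * I` turns a logarithm of `γ - δ` into one of `δ - γ` and keeps the increments. -/
theorem exists_logIncrement_square {a b c d : ℂ} (γ : Path a b) (δ : Path c d)
    (h : Disjoint (Set.range γ) (Set.range δ)) :
    ∃ θc θd φa φb, IsLogIncrement γ c θc ∧ IsLogIncrement γ d θd ∧ IsLogIncrement δ a φa ∧
      IsLogIncrement δ b φb ∧ θc + φb = φa + θd := by
  have hne : ∀ p : ℝ × ℝ, γ.extend p.1 - δ.extend p.2 ≠ 0 := by
    intro p hp
    refine Set.disjoint_left.mp h (?_ : γ.extend p.1 ∈ _) ?_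
    · rw [← Path.extend_range γ]; exact ⟨_, rfl⟩
    · rw [← Path.extend_range δ, sub_eq_zero.mp hp]; exact ⟨_, rfl⟩
  obtain ⟨L, hL, hexp⟩ := exists_continuous_log (F := fun p => γ.extend p.1 - δ.extend p.2)
    (by fun_prop) hne
  refine ⟨L (1, 0) - L (0, 0), L (1, 1) - L (0, 1), L (0, 1) - L (0, 0), L (1, 1) - L (1, 0),
    ⟨fun t => L (t, 0), by fun_prop, fun t => by simp [hexp], rfl⟩,
    ⟨fun t => L (t, 1), by fun_prop, fun t => by simp [hexp], rfl⟩,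
    ⟨fun t => L (0, t) + Real.pi * I, by fun_prop, fun t => by
      rw [exp_add, hexp, exp_pi_mul_I]; simp, by ring⟩,
    ⟨fun t => L (1, t) + Real.pi * I, by fun_prop, fun t => by
      rw [exp_add, hexp, exp_pi_mul_I]; simp, by ring⟩, by ring⟩

/-- Reversing a difference changes its logarithm by an odd multiple of `π * I`. Fixing that multiple
by the order of the indices makes the half turns countable. -/
theorem exists_log_sub {z : Fin 3 → ℂ} (hz : Function.Injective z) :
    ∃ L : Fin 3 → Fin 3 → ℂ, (∀ i i', i ≠ i' → exp (L i i') = z i - z i') ∧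
      ∀ i i', i < i' → L i' i = L i i' + Real.pi * I := by
  refine ⟨fun i i' => if i < i' then log (z i - z i') else log (z i' - z i) + Real.pi * I,
    fun i i' h => ?_, fun i i' h => ?_⟩
  · have h1 : z i - z i' ≠ 0 := sub_ne_zero.mpr (hz.ne h)
    have h2 : z i' - z i ≠ 0 := sub_ne_zero.mpr (hz.ne h.symm)
    dsimp only
    split_ifs
    · exact exp_log h1
    · rw [exp_add, exp_log h2, exp_pi_mul_I]; ring
  · simp [h, h.le]

theorem IsLogIncrement.exists_int {u v p θ l l' : ℂ} {γ : Path u v} (h : IsLogIncrement γ p θ)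
    (hl : exp l = u - p) (hl' : exp l' = v - p) :
    ∃ n : ℤ, θ = l' - l + n * (2 * Real.pi * I) := by
  have h1 := h.exp_mul
  rw [← hl, ← hl', ← exp_add, exp_eq_exp_iff_exists_int] at h1
  obtain ⟨n, hn⟩ := h1
  exact ⟨n, by rw [← sub_eq_iff_eq_add.mpr hn]; ring⟩

/-- `K₃,₃` cannot be drawn in the plane so that independent edges are disjoint. -/
theorem not_disjoint_paths_K33 {x y : Fin 3 → ℂ} (γ : ∀ i j, Path (x i) (y j))
    (h : ∀ i i' j j', i ≠ i' → j ≠ j' →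
      Disjoint (Set.range (γ i j)) (Set.range (γ i' j'))) : False := by
  have hex : ∀ i : Fin 3, ∃ i', i ≠ i' := by decide
  have hx : Function.Injective x := by
    intro i i' hii
    by_contra hne
    exact Set.disjoint_left.mp (h i i' 0 1 hne (by decide)) ⟨0, (γ i 0).source⟩
      ⟨0, by rw [(γ i' 1).source, hii]⟩
  have hy : Function.Injective y := by
    intro j j' hjj
    by_contra hne
    exact Set.disjoint_left.mp (h 0 1 j j' (by decide) hne) ⟨1, (γ 0 j).target⟩
      ⟨1, by rw [(γ 1 j').target, hjj]⟩
  have hxy : ∀ i j, x i ≠ y j := by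
    intro i j hij
    obtain ⟨i', hi⟩ := hex i
    obtain ⟨j', hj⟩ := hex j
    exact Set.disjoint_left.mp (h i i' j' j hi hj.symm) ⟨0, (γ i j').source⟩
      ⟨1, by rw [(γ i' j).target, hij]⟩
  obtain ⟨X, hX, hX'⟩ := exists_log_sub hx
  obtain ⟨Y, hY, hY'⟩ := exists_log_sub hy
  obtain ⟨Z, hZ⟩ : ∃ Z : Fin 3 → Fin 3 → ℂ, ∀ i j, exp (Z i j) = x i - y j :=
    ⟨fun i j => log (x i - y j), fun i j => exp_log (sub_ne_zero.mpr (hxy i j))⟩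
  have hn : ∀ i j i', i ≠ i' → ∃ n : ℤ, IsLogIncrement (γ i j) (x i')
      (Z i' j + Real.pi * I - X i i' + n * (2 * Real.pi * I)) := by
    intro i j i' hi
    obtain ⟨j', hj⟩ := hex j
    obtain ⟨θ, -, -, -, hθ, -⟩ := exists_logIncrement_square _ _ (h i i' j j' hi hj)
    obtain ⟨n, rfl⟩ := hθ.exists_int (hX i i' hi) (l' := Z i' j + Real.pi * I)
      (by rw [exp_add, hZ, exp_pi_mul_I]; ring)
    exact ⟨n, hθ⟩
  have hm : ∀ i j j', j ≠ j' → ∃ m : ℤ, IsLogIncrement (γ i j) (y j')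
      (Y j j' - Z i j' + m * (2 * Real.pi * I)) := by
    intro i j j' hj
    obtain ⟨i', hi⟩ := hex i
    obtain ⟨-, θ, -, -, -, hθ, -⟩ := exists_logIncrement_square _ _ (h i i' j j' hi hj)
    obtain ⟨m, rfl⟩ := hθ.exists_int (hZ i j') (hY j j' hj)
    exact ⟨m, hθ⟩
  choose! n hn using hn
  choose! m hm using hm
  have key : ∀ i i' j j', i ≠ i' → j ≠ j' →
      Z i' j + Real.pi * I - X i i' + n i j i' * (2 * Real.pi * I) +
        (Y j' j - Z i' j + m i' j' j * (2 * Real.pi * I)) =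
      Z i j' + Real.pi * I - X i' i + n i' j' i * (2 * Real.pi * I) +
        (Y j j' - Z i j' + m i j j' * (2 * Real.pi * I)) := by
    intro i i' j j' hi hj
    obtain ⟨θc, θd, φa, φb, h1, h2, h3, h4, h5⟩ :=
      exists_logIncrement_square _ _ (h i i' j j' hi hj)
    rw [h1.unique (hn i j i' hi), h2.unique (hm i j j' hj), h3.unique (hn i' j' i hi.symm),
      h4.unique (hm i' j' j hj.symm)] at h5
    exact h5
  have hpi : (2 * Real.pi * I : ℂ) ≠ 0 := two_pi_I_ne_zero
  have key1 : ∀ i i' j j', i < i' → j < j' →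
      n i j i' + m i' j' j - n i' j' i - m i j j' = -1 := by
    intro i i' j j' hi hj
    have h1 := key i i' j j' hi.ne hj.ne
    rw [hX' i i' hi, hY' j j' hj] at h1
    have h2 : ((n i j i' + m i' j' j - n i' j' i - m i j j' : ℤ) : ℂ) = (-1 : ℤ) := by
      apply mul_right_cancel₀ hpi
      push_cast
      linear_combination h1
    exact_mod_cast h2
  have key2 : ∀ i i' j j', i < i' → j' < j →
      n i j i' + m i' j' j - n i' j' i - m i j j' = 0 := by
    intro i i' j j' hi hj
    have h1 := key i i' j j' hi.ne hj.ne'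
    rw [hX' i i' hi, hY' j' j hj] at h1
    have h2 : ((n i j i' + m i' j' j - n i' j' i - m i j j' : ℤ) : ℂ) = (0 : ℤ) := by
      apply mul_right_cancel₀ hpi
      push_cast
      linear_combination h1
    exact_mod_cast h2
  -- Add up all eighteen relations: each unknown `n` or `m` occurs in exactly two of them, with
  -- coefficient `1` or `-1`, so the left side is even, while the right side is `-9`.
  have a1 := key1 0 1 0 1 (by decide) (by decide)
  have a2 := key1 0 1 0 2 (by decide) (by decide)
  have a3 := key1 0 1 1 2 (by decide) (by decide)
  have a4 := key1 0 2 0 1 (by decide) (by decide)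
  have a5 := key1 0 2 0 2 (by decide) (by decide)
  have a6 := key1 0 2 1 2 (by decide) (by decide)
  have a7 := key1 1 2 0 1 (by decide) (by decide)
  have a8 := key1 1 2 0 2 (by decide) (by decide)
  have a9 := key1 1 2 1 2 (by decide) (by decide)
  have b1 := key2 0 1 1 0 (by decide) (by decide)
  have b2 := key2 0 1 2 0 (by decide) (by decide)
  have b3 := key2 0 1 2 1 (by decide) (by decide)
  have b4 := key2 0 2 1 0 (by decide) (by decide)
  have b5 := key2 0 2 2 0 (by decide) (by decide)
  have b6 := key2 0 2 2 1 (by decide) (by decide)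
  have b7 := key2 1 2 1 0 (by decide) (by decide)
  have b8 := key2 1 2 2 0 (by decide) (by decide)
  have b9 := key2 1 2 2 1 (by decide) (by decide)
  omega

end

/-! ### From plane drawings to `K₃,₃` in planar graphs -/

section
open SimpleGraph

variable {V : Type*} {G : SimpleGraph V}

/-- Concatenate the arcs of the edges. Injectivity is not kept, as the logarithm argument works for
arbitrary curves. -/
theorem exists_path_of_walk {point : V → Plane} {curve : Sym2 V → Set Plane}
    (harc : ∀ u v : V, G.Adj u v →
      ∃ γ : Path (point u) (point v), Function.Injective γ ∧ Set.range γ = curve s(u, v))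
    {u v : V} (w : G.Walk u v) :
    ∃ γ : Path (point u) (point v),
      ∀ t, (∃ x ∈ w.support, γ t = point x) ∨ ∃ e ∈ w.edges, γ t ∈ curve e := by
  induction w with
  | nil => exact ⟨Path.refl _, fun t => Or.inl ⟨_, by simp, rfl⟩⟩
  | @cons a b c h p ih =>
    obtain ⟨γ, hγ⟩ := ih
    obtain ⟨δ, -, hδ⟩ := harc _ _ h
    refine ⟨δ.trans γ, fun t => ?_⟩
    have ht : δ.trans γ t ∈ Set.range (δ.trans γ) := ⟨t, rfl⟩
    rw [Path.trans_range] at ht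
    rcases ht with ht | ⟨s, hs⟩
    · exact Or.inr ⟨s(a, b), by simp, hδ ▸ ht⟩
    · rw [← hs]
      rcases hγ s with ⟨x, hx, hx'⟩ | ⟨e, he, he'⟩
      · exact Or.inl ⟨x, by simp [hx], hx'⟩
      · exact Or.inr ⟨e, by simp [he], he'⟩

/-- A planar graph has no subdivision of `K₃,₃`, even if adjacent subdivided edges may meet. -/
theorem IsPlanar.not_disjoint_walks_K33 (hG : IsPlanar G) {a b : Fin 3 → V}
    (w : ∀ i j, G.Walk (a i) (b j))
    (hw : ∀ i i' j j', i < i' → j ≠ j' → (w i j).support.Disjoint (w i' j').support) :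
    False := by
  obtain ⟨point, curve, hinj, harc, hvert, hedge⟩ := hG
  choose γ hγ using fun i j => exists_path_of_walk harc (w i j)
  let φ : Plane → ℂ := fun p => p 0 + p 1 * Complex.I
  have hφ : Continuous φ := by fun_prop
  have hφi : Function.Injective φ := by
    intro p q hpq
    have h0 := congr_arg Complex.re hpq
    have h1 := congr_arg Complex.im hpq
    simp only [φ, Complex.add_re, Complex.add_im, Complex.ofReal_re, Complex.ofReal_im,
      Complex.re_ofReal_mul, Complex.im_ofReal_mul, Complex.I_re, Complex.I_im, mul_zero,
      mul_one, add_zero, zero_add] at h0 h1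
    ext k
    fin_cases k
    · exact h0
    · exact h1
  have key : ∀ i i' j j', i < i' → j ≠ j' →
      Disjoint (Set.range ((γ i j).map hφ)) (Set.range ((γ i' j').map hφ)) := by
    intro i i' j j' hi hj
    have hd := hw i i' j j' hi hj
    rw [Set.disjoint_left]
    rintro _ ⟨s, rfl⟩ ⟨t, ht⟩
    have hst : γ i j s = γ i' j' t := (hφi ht).symm
    rcases hγ i j s with ⟨x, hx, hx'⟩ | ⟨e, he, he'⟩ <;>
      rcases hγ i' j' t with ⟨y, hy, hy'⟩ | ⟨e₂, he₂, he₂'⟩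
    · rw [hx', hy'] at hst
      exact hd hx (hinj hst ▸ hy)
    · rw [← hst, hx'] at he₂'
      exact hd hx (Walk.mem_support_of_mem_edges he₂
        (hvert _ (Walk.edges_subset_edgeSet _ he₂) _ he₂'))
    · rw [hst, hy'] at he'
      exact hd (Walk.mem_support_of_mem_edges he
        (hvert _ (Walk.edges_subset_edgeSet _ he) _ he')) hy
    · have hne : e ≠ e₂ := by
        rintro rfl
        induction e with
        | _ p q =>
          exact hd (Walk.fst_mem_support_of_mem_edges _ he)
            (Walk.fst_mem_support_of_mem_edges _ he₂)
      obtain ⟨z, ⟨hz, hz₂⟩, -⟩ := hedge e (Walk.edges_subset_edgeSet _ he) e₂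
        (Walk.edges_subset_edgeSet _ he₂) hne ⟨he', hst ▸ he₂'⟩
      exact hd (Walk.mem_support_of_mem_edges he hz) (Walk.mem_support_of_mem_edges he₂ hz₂)
  refine not_disjoint_paths_K33 (fun i j => (γ i j).map hφ) fun i i' j j' hi hj => ?_
  rcases hi.lt_or_gt with hi | hi
  · exact key i i' j j' hi hj
  · exact (key i' i j' j hi hj.symm).symm

end

/-! ### Separation in trees and the Kőnig property of tree paths -/

section
open SimpleGraph

variable {V : Type*} {T : SimpleGraph V}

/-- `a` and `b` are joined by a walk that does not pass through `v`. -/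
def ReachableAvoiding (T : SimpleGraph V) (v a b : V) : Prop :=
  ∃ w : T.Walk a b, v ∉ w.support

namespace ReachableAvoiding

variable {v a b c : V}

theorem refl (h : a ≠ v) : ReachableAvoiding T v a a := ⟨.nil, by simpa using h.symm⟩

theorem symm (h : ReachableAvoiding T v a b) : ReachableAvoiding T v b a := by
  obtain ⟨w, hw⟩ := h
  exact ⟨w.reverse, by simpa using hw⟩

theorem trans (h : ReachableAvoiding T v a b) (h' : ReachableAvoiding T v b c) :
    ReachableAvoiding T v a c := by
  obtain ⟨w, hw⟩ := h
  obtain ⟨w', hw'⟩ := h'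
  exact ⟨w.append w', by simp [Walk.mem_support_append_iff, hw, hw']⟩

theorem ne_left (h : ReachableAvoiding T v a b) : a ≠ v := by
  obtain ⟨w, hw⟩ := h
  rintro rfl
  exact hw w.start_mem_support

theorem ne_right (h : ReachableAvoiding T v a b) : b ≠ v := h.symm.ne_left

theorem of_adj (h : T.Adj a b) (ha : a ≠ v) (hb : b ≠ v) : ReachableAvoiding T v a b :=
  ⟨.cons h .nil, by simp [ha.symm, hb.symm]⟩

end ReachableAvoiding

section Walks

variable [DecidableEq V] {v a b c u : V}

theorem reachableAvoiding_of_mem_support_right {w : T.Walk a b} (hv : v ∉ w.support)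
    (hu : u ∈ w.support) : ReachableAvoiding T v u b :=
  ⟨w.dropUntil u hu, fun h => hv (w.support_dropUntil_subset_support hu h)⟩

theorem reachableAvoiding_of_mem_support_left {w : T.Walk a b} (hv : v ∉ w.support)
    (hu : u ∈ w.support) : ReachableAvoiding T v a u :=
  ⟨w.takeUntil u hu, fun h => hv (w.support_takeUntil_subset_support hu h)⟩

theorem not_reachableAvoiding_of_mem_support (hT : T.IsAcyclic) {p : T.Walk a b}
    (hp : p.IsPath) (hv : v ∈ p.support) : ¬ ReachableAvoiding T v a b := by
  rintro ⟨w, hw⟩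
  have h : p = w.bypass :=
    congr_arg Subtype.val ((hT.subsingleton_path _ _).elim ⟨p, hp⟩ w.toPath)
  rw [h] at hv
  exact hw (w.support_bypass_subset_support hv)

/-- In a forest, `v` has at most one neighbour in each component that is left by deleting `v`. -/
theorem eq_of_adj_of_reachableAvoiding (hT : T.IsAcyclic) (ha : T.Adj v a)
    (hb : T.Adj v b) (h : ReachableAvoiding T v a b) : a = b := by
  obtain ⟨w, hw⟩ := h
  have h1 : (Walk.cons ha w.bypass).IsPath :=
    (w.bypass_isPath).cons fun h => hw (w.support_bypass_subset_support h)
  have h2 : (Walk.cons hb Walk.nil).IsPath := by simp [hb.ne]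
  have h3 := congr_arg (fun q => q.1.snd) ((hT.subsingleton_path _ _).elim ⟨_, h1⟩ ⟨_, h2⟩)
  simpa using h3

/-- A vertex `w` of a path is joined to one of its ends without passing through `v ≠ w`. -/
theorem reachableAvoiding_or_of_mem_support {p : T.Walk a b} (hp : p.IsPath)
    (hu : u ∈ p.support) (huv : u ≠ v) :
    ReachableAvoiding T v u a ∨ ReachableAvoiding T v u b := by
  by_cases h1 : v ∈ (p.takeUntil u hu).support
  · right
    refine ⟨p.dropUntil u hu, fun h2 => ?_⟩
    have h := hp.support_nodup
    rw [← p.take_spec hu, Walk.support_append, List.nodup_append'] at h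
    rw [Walk.mem_support_iff] at h2
    rcases h2 with rfl | h2
    · exact huv rfl
    · exact h.2.2 h1 h2
  · exact Or.inl (ReachableAvoiding.symm ⟨_, h1⟩)

end Walks

/-- `w` lies on the path from `a` to `b` in a tree. -/
abbrev Between (T : SimpleGraph V) (a w b : V) : Prop := ¬ ReachableAvoiding T w a b

/-- With the tree rooted at `r`, `Between T r v w` says that `w` is in the subtree below `v`. If `a`
and `b` are below `v` and in one component of `T - v`, both are below the same child `u` of `v`,
whose subtree is strictly smaller. -/
theorem exists_child_between (hT : T.IsTree) {r v a b : V} (hab : ReachableAvoiding T v a b)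
    (ha : Between T r v a) (hb : Between T r v b) :
    ∃ u, Between T r u a ∧ Between T r u b ∧ (∀ w, Between T r u w → Between T r v w) ∧
      ¬ Between T r u v := by
  classical
  have step : ∀ c, ReachableAvoiding T v c a → Between T r v c →
      ∃ u, T.Adj v u ∧ ReachableAvoiding T v u c ∧ Between T r u c := by
    intro c hca hc
    obtain ⟨p, hp, -⟩ := hT.existsUnique_path v c
    cases p with
    | nil => exact absurd rfl hca.ne_left
    | @cons _ u _ h p =>
      have hv : v ∉ p.support := ((Walk.cons_isPath_iff _ _).mp hp).2
      refine ⟨u, h, ⟨p, hv⟩, ?_⟩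
      rintro ⟨q, hq⟩
      have hvq : v ∈ q.support := by
        by_contra hvq
        exact hc ⟨q, hvq⟩
      exact not_reachableAvoiding_of_mem_support hT.isAcyclic hp (v := u) (by simp)
        (reachableAvoiding_of_mem_support_right hq hvq)
  obtain ⟨u, hu, hua, hru⟩ := step a (.refl hab.ne_left) ha
  obtain ⟨u', hu', hub, hru'⟩ := step b hab.symm hb
  obtain rfl : u = u' :=
    eq_of_adj_of_reachableAvoiding hT.isAcyclic hu hu' ((hua.trans hab).trans hub.symm)
  refine ⟨u, hru, hru', ?_, ?_⟩
  · rintro w hw ⟨q, hq⟩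
    refine hw ⟨q, fun huq => ?_⟩
    exact ha ((reachableAvoiding_of_mem_support_left hq huq).trans hua)
  · obtain ⟨q, hq, -⟩ := hT.existsUnique_path r v
    refine not_not.mpr ⟨q, fun huq => ?_⟩
    refine ha (ReachableAvoiding.trans ⟨q.takeUntil u huq, ?_⟩ hua)
    exact Walk.endpoint_notMem_support_takeUntil hq huq hu.ne

/-- The paths in a tree have the Kőnig property: some set of vertices that meets all paths of a
family consists of one vertex from each of a number of pairwise disjoint members. -/
theorem exists_hitting_set_of_paths [Finite V] (hT : T.IsTree) {ι : Type*} [Nonempty ι]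
    (a b : ι → V) (D : Finset ι) :
    ∃ (X : Set V) (e : V → ι), (∀ v ∈ X, e v ∈ D ∧ Between T (a (e v)) v (b (e v))) ∧
      (∀ v ∈ X, ∀ v' ∈ X, v ≠ v' → ∀ w, ¬ (Between T (a (e v)) w (b (e v)) ∧
        Between T (a (e v')) w (b (e v')))) ∧
      ∀ i ∈ D, ∃ v ∈ X, Between T (a i) v (b i) := by
  classical
  obtain ⟨r⟩ := hT.connected.nonempty
  induction D using Finset.strongInduction with
  | H D ih =>
  rcases D.eq_empty_or_nonempty with rfl | ⟨i₀, hi₀⟩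
  · exact ⟨∅, fun _ => Classical.arbitrary ι, by simp, by simp, by simp⟩
  let P : V → Prop := fun v => ∃ i ∈ D, Between T r v (a i) ∧ Between T r v (b i)
  have hr : P r := ⟨i₀, hi₀, fun h => h.ne_left rfl, fun h => h.ne_left rfl⟩
  -- Greedy choice: a smallest subtree that contains both ends of some path of the family. By
  -- minimality, every path with both ends below `v` passes through `v`.
  obtain ⟨v, ⟨i, hi, hva, hvb⟩, hmin⟩ : ∃ v, P v ∧ ∀ u, P u →
      {w | Between T r v w}.ncard ≤ {w | Between T r u w}.ncard :=
    Set.exists_min_image {v | P v} (fun v => {w | Between T r v w}.ncard) (Set.toFinite _) ⟨r, hr⟩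
  have hout : ∀ j ∈ D, ReachableAvoiding T v (a j) (b j) → Between T r v (a j) →
      Between T r v (b j) → False := by
    intro j hj hab ha hb
    obtain ⟨u, hua, hub, hsub, huv⟩ := exists_child_between hT hab ha hb
    refine (hmin u ⟨j, hj, hua, hub⟩).not_gt (Set.ncard_lt_ncard ⟨hsub, fun h => huv (h ?_)⟩)
    exact fun h => h.ne_right rfl
  have hiv : Between T (a i) v (b i) := fun h => hout i hi h hva hvb
  obtain ⟨X, e, h1, h2, h3⟩ := ih (D.filter fun j => ReachableAvoiding T v (a j) (b j))
    (Finset.filter_ssubset.mpr ⟨i, hi, hiv⟩)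
  simp only [Finset.mem_filter] at h1 h3
  have hvX : v ∉ X := fun h => (h1 v h).2 (h1 v h).1.2
  have hne : ∀ x ∈ X, x ≠ v := fun x hx h => hvX (h ▸ hx)
  -- A remaining path avoids `v`. If it met path `i` in a vertex `w`, then `w` would be below `v`,
  -- and with it both ends of the remaining path, against `hout`.
  have hdisj : ∀ x ∈ X, ∀ w, ¬ (Between T (a i) w (b i) ∧ Between T (a (e x)) w (b (e x))) := by
    rintro x hx w ⟨hw1, hw2⟩
    obtain ⟨⟨hxD, q, hq⟩, -⟩ := h1 x hx
    have hwq : w ∈ q.support := by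
      by_contra h
      exact hw2 ⟨q, h⟩
    have hwv : w ≠ v := fun h => hq (h ▸ hwq)
    have hrw : Between T r v w := by
      intro h
      obtain ⟨p, hp, -⟩ := hT.existsUnique_path (a i) (b i)
      have hwp : w ∈ p.support := by
        by_contra h
        exact hw1 ⟨p, h⟩
      rcases reachableAvoiding_or_of_mem_support hp hwp hwv with h' | h'
      · exact hva (h.trans h')
      · exact hvb (h.trans h')
    refine hout (e x) hxD ⟨q, hq⟩ (fun h => hrw ?_) (fun h => hrw ?_)
    · exact h.trans (reachableAvoiding_of_mem_support_left hq hwq)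
    · exact h.trans (reachableAvoiding_of_mem_support_right hq hwq).symm
  refine ⟨insert v X, Function.update e v i, ?_, ?_, ?_⟩
  · rintro x (rfl | hx)
    · simpa using ⟨hi, hiv⟩
    · rw [Function.update_of_ne (hne x hx)]
      exact ⟨(h1 x hx).1.1, (h1 x hx).2⟩
  · rintro x (rfl | hx) y (rfl | hy) hxy w
    · exact absurd rfl hxy
    · rw [Function.update_self, Function.update_of_ne (hne y hy)]
      exact hdisj y hy w
    · rw [Function.update_self, Function.update_of_ne (hne x hx), and_comm]
      exact hdisj x hx w
    · rw [Function.update_of_ne (hne x hx), Function.update_of_ne (hne y hy)]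
      exact h2 x hx y hy hxy w
  · intro j hj
    by_cases h : ReachableAvoiding T v (a j) (b j)
    · obtain ⟨x, hx, hx'⟩ := h3 j ⟨hj, h⟩
      exact ⟨x, Or.inr hx, hx'⟩
    · exact ⟨v, Or.inl rfl, h⟩

end

/-! ### Planarity forbids crossing leaves -/

section
open SimpleGraph

variable {V : Type*} {G T : SimpleGraph V}

theorem exists_adj_reachableAvoiding (hT : T.Connected) {v w : V} (hw : w ≠ v) :
    ∃ (k : V) (p : T.Walk v w) (q : T.Walk k w), p.IsPath ∧ T.Adj v k ∧ v ∉ q.support ∧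
      ∀ x, x ∈ p.support ↔ x = v ∨ x ∈ q.support := by
  obtain ⟨p, hp⟩ := hT.exists_isPath v w
  cases p with
  | nil => exact absurd rfl hw
  | @cons _ u _ h p =>
    exact ⟨u, _, p, hp, h, ((Walk.cons_isPath_iff _ _).mp hp).2, by simp⟩

theorem IsLeaf.reachableAvoiding (hT : T.Connected) {v a b : V} (hv : IsLeaf T v)
    (ha : a ≠ v) (hb : b ≠ v) : ReachableAvoiding T v a b := by
  obtain ⟨k, -, q, -, hk, hq, -⟩ := exists_adj_reachableAvoiding hT ha
  obtain ⟨k', -, q', -, hk', hq', -⟩ := exists_adj_reachableAvoiding hT hb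
  obtain rfl := hv.unique hk hk'
  exact ReachableAvoiding.trans (ReachableAvoiding.symm ⟨q, hq⟩) ⟨q', hq'⟩

theorem IsLeaf.eq_or_eq_of_mem_support (hT : T.IsTree) {v a b : V} (hv : IsLeaf T v)
    {p : T.Walk a b} (hp : p.IsPath) (h : v ∈ p.support) : v = a ∨ v = b := by
  classical
  by_contra! hne
  exact not_reachableAvoiding_of_mem_support hT.isAcyclic hp h
    (hv.reachableAvoiding hT.connected hne.1.symm hne.2.symm)

/-- Two leaves in a component of `T - v` are not separated, on a cycle through the leaves, by two
leaves outside of that component. -/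
theorem not_crossing (hG : IsPlanar G) (hT : T.IsTree) (hTG : T ≤ G) {v a b c d : V}
    (pab : G.Walk a b) (pcb : G.Walk c b) (pcd : G.Walk c d) (pad : G.Walk a d)
    (lab : ∀ x ∈ pab.support, IsLeaf T x) (lcb : ∀ x ∈ pcb.support, IsLeaf T x)
    (lcd : ∀ x ∈ pcd.support, IsLeaf T x) (lad : ∀ x ∈ pad.support, IsLeaf T x)
    (hd₁ : pab.support.Disjoint pcd.support) (hd₂ : pcb.support.Disjoint pad.support)
    (hac : ReachableAvoiding T v a c) (hab : Between T a v b) (had : Between T a v d) : False := by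
  classical
  have ha₁ := pab.start_mem_support
  have ha₂ := pad.start_mem_support
  have hb₁ := pab.end_mem_support
  have hb₂ := pcb.end_mem_support
  have hc₁ := pcb.start_mem_support
  have hc₂ := pcd.start_mem_support
  have hd₃ := pcd.end_mem_support
  have hd₄ := pad.end_mem_support
  have hbd : b ≠ d := fun h => hd₁ hb₁ (h ▸ hd₃)
  have hca : a ≠ c := fun h => hd₁ ha₁ (h ▸ hc₂)
  have hvl : ¬ IsLeaf T v := by
    intro hv
    by_cases h : b = v
    · exact had (hv.reachableAvoiding hT.connected hac.ne_left (h ▸ hbd.symm))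
    · exact hab (hv.reachableAvoiding hT.connected hac.ne_left h)
  have hbv : b ≠ v := fun h => hvl (h ▸ lab b hb₁)
  have hdv : d ≠ v := fun h => hvl (h ▸ lad d hd₄)
  obtain ⟨k, qa, pa, hqa, hk, hpa, hma⟩ := exists_adj_reachableAvoiding hT.connected hac.ne_left
  obtain ⟨k', qc, pc, hqc, hk', hpc, hmc⟩ := exists_adj_reachableAvoiding hT.connected hac.ne_right
  obtain rfl : k' = k :=
    eq_of_adj_of_reachableAvoiding hT.isAcyclic hk' hk
    ((ReachableAvoiding.trans ⟨pc, hpc⟩ hac.symm).trans (ReachableAvoiding.symm ⟨pa, hpa⟩))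
  obtain ⟨kb, qb, pb, hqb, hkb, hpb, hmb⟩ := exists_adj_reachableAvoiding hT.connected hbv
  obtain ⟨kd, qd, pd, hqd, hkd, hpd, hmd⟩ := exists_adj_reachableAvoiding hT.connected hdv
  have la : ∀ x ∈ pa.support, IsLeaf T x → x = a := fun x hx hl =>
    (hl.eq_or_eq_of_mem_support hT hqa ((hma x).mpr (Or.inr hx))).resolve_left
      fun h => hvl (h ▸ hl)
  have lc : ∀ x ∈ pc.support, IsLeaf T x → x = c := fun x hx hl =>
    (hl.eq_or_eq_of_mem_support hT hqc ((hmc x).mpr (Or.inr hx))).resolve_left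
      fun h => hvl (h ▸ hl)
  have lb : ∀ x ∈ qb.support, IsLeaf T x → x = b := fun x hx hl =>
    (hl.eq_or_eq_of_mem_support hT hqb hx).resolve_left fun h => hvl (h ▸ hl)
  have ld : ∀ x ∈ qd.support, IsLeaf T x → x = d := fun x hx hl =>
    (hl.eq_or_eq_of_mem_support hT hqd hx).resolve_left fun h => hvl (h ▸ hl)
  have hkl : ¬ IsLeaf T k' := fun hl =>
    hca ((la k' pa.start_mem_support hl).symm.trans (lc k' pc.start_mem_support hl))
  have ra : ∀ x ∈ pa.support, ReachableAvoiding T v a x := fun x hx =>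
    (reachableAvoiding_of_mem_support_right hpa hx).symm
  have rc : ∀ x ∈ pc.support, ReachableAvoiding T v a x := fun x hx =>
    hac.trans (reachableAvoiding_of_mem_support_right hpc hx).symm
  have rb : ∀ x ∈ qb.support, ¬ ReachableAvoiding T v a x := by
    intro x hx h
    rcases (hmb x).mp hx with rfl | hx
    · exact h.ne_right rfl
    · exact hab (h.trans (reachableAvoiding_of_mem_support_right hpb hx))
  have rd : ∀ x ∈ qd.support, ¬ ReachableAvoiding T v a x := by
    intro x hx h
    rcases (hmd x).mp hx with rfl | hx
    · exact h.ne_right rfl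
    · exact had (h.trans (reachableAvoiding_of_mem_support_right hpd hx))
  have nl : ∀ x ∈ (Walk.cons (hTG hk') .nil : G.Walk v k').support, ¬ IsLeaf T x := by
    intro x hx
    simp only [Walk.support_cons, Walk.support_nil, List.mem_cons, List.not_mem_nil,
      or_false] at hx
    rcases hx with rfl | rfl
    · exact hvl
    · exact hkl
  obtain ⟨wa, hwa⟩ : ∃ w : G.Walk a k', ∀ x, x ∈ w.support → x ∈ pa.support :=
    ⟨(pa.mapLe hTG).reverse, by simp⟩
  obtain ⟨wc, hwc⟩ : ∃ w : G.Walk c k', ∀ x, x ∈ w.support → x ∈ pc.support :=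
    ⟨(pc.mapLe hTG).reverse, by simp⟩
  obtain ⟨wb, hwb⟩ : ∃ w : G.Walk v b, ∀ x, x ∈ w.support → x ∈ qb.support :=
    ⟨qb.mapLe hTG, by simp⟩
  obtain ⟨wd, hwd⟩ : ∃ w : G.Walk v d, ∀ x, x ∈ w.support → x ∈ qd.support :=
    ⟨qd.mapLe hTG, by simp⟩
  -- The sides of the `K₃,₃` are `a, c, v` and `b, d, k'`, where `k'` is the neighbour of `v` in the
  -- component of `a` and `c`. The walks to `k'` from `a` and `c` stay in that component, and those
  -- from `v` to `b` and `d` stay out of it. The walks to `k'` may overlap, and so may those from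
  -- `v`, but these share an end in `K₃,₃`.
  let w : ∀ i j : Fin 3, G.Walk (![a, c, v] i) (![b, d, k'] j) := fun i j =>
    match i, j with
    | 0, 0 => pab
    | 0, 1 => pad
    | 0, 2 => wa
    | 1, 0 => pcb
    | 1, 1 => pcd
    | 1, 2 => wc
    | 2, 0 => wb
    | 2, 1 => wd
    | 2, 2 => .cons (hTG hk') .nil
  refine hG.not_disjoint_walks_K33 w fun i i' j j' hi hj x hx hx' => ?_
  fin_cases i <;> fin_cases i' <;> first | exact absurd hi (by decide) | skip
  all_goals fin_cases j <;> fin_cases j' <;> first | exact absurd rfl hj | skip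
  · exact hd₁ hx hx'
  · rw [lc x (hwc x hx') (lab x hx)] at hx
    exact hd₁ hx hc₂
  · exact hd₂ hx' hx
  · rw [lc x (hwc x hx') (lad x hx)] at hx
    exact hd₂ hc₁ hx
  · rw [la x (hwa x hx) (lcb x hx')] at hx'
    exact hd₂ hx' ha₂
  · rw [la x (hwa x hx) (lcd x hx')] at hx'
    exact hd₁ ha₁ hx'
  · rw [ld x (hwd x hx') (lab x hx)] at hx
    exact hd₁ hx hd₃
  · exact nl x hx' (lab x hx)
  · rw [lb x (hwb x hx') (lad x hx)] at hx
    exact hd₂ hb₂ hx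
  · exact nl x hx' (lad x hx)
  · exact rb x (hwb x hx') (ra x (hwa x hx))
  · exact rd x (hwd x hx') (ra x (hwa x hx))
  · rw [ld x (hwd x hx') (lcb x hx)] at hx
    exact hd₂ hx hd₄
  · exact nl x hx' (lcb x hx)
  · rw [lb x (hwb x hx') (lcd x hx)] at hx
    exact hd₁ hb₁ hx
  · exact nl x hx' (lcd x hx)
  · exact rb x (hwb x hx') (rc x (hwc x hx))
  · exact rd x (hwd x hx') (rc x (hwc x hx))

end

/-! ### Halin graphs: the feedback vertex set and the packing -/

section
open SimpleGraph

variable {V : Type*} {G T : SimpleGraph V} {n : ℕ} {f : ℕ → V}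

/-- `G` consists of the tree `T` and the cycle `f 0, f 1, …, f n = f 0` through its leaves. -/
structure IsHalinPresentation (G T : SimpleGraph V) (n : ℕ) (f : ℕ → V) : Prop where
  planar : IsPlanar G
  isTree : T.IsTree
  three_le : 3 ≤ n
  injOn : ∀ i j, i < n → j < n → f i = f j → i = j
  closed : f n = f 0
  isLeaf_iff : ∀ v, IsLeaf T v ↔ ∃ i < n, f i = v
  adj_iff : ∀ u v, G.Adj u v ↔ T.Adj u v ∨ ∃ i < n, s(u, v) = s(f i, f (i + 1))

theorem IsHalin.exists_presentation (hG : IsHalin G) :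
    ∃ (T : SimpleGraph V) (n : ℕ) (f : ℕ → V), IsHalinPresentation G T n f := by
  obtain ⟨hplanar, T, hT, u, c, hc, hleaf, rfl⟩ := hG
  have h3 := hc.three_le_length
  refine ⟨T, c.length, c.getVert, hplanar, hT, h3, ?_, by simp, ?_, ?_⟩
  · intro i j hi hj hij
    exact hc.getVert_injOn' (by rw [Set.mem_ofPred_eq]; lia) (by rw [Set.mem_ofPred_eq]; lia) hij
  · intro v
    rw [← hleaf, Walk.mem_support_iff_exists_getVert]
    constructor
    · rintro ⟨i, hi, hin⟩
      rcases hin.lt_or_eq with h | rfl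
      · exact ⟨i, h, hi⟩
      · exact ⟨0, by lia, by rw [← hi]; simp⟩
    · rintro ⟨i, hi, hin⟩
      exact ⟨i, hin, hi.le⟩
  · intro x y
    have hedge : ∀ e, e ∈ c.edges ↔ ∃ i < c.length, e = s(c.getVert i, c.getVert (i + 1)) := by
      intro e
      rw [List.mem_iff_getElem]
      simp only [Walk.length_edges, Walk.getElem_edges]
      constructor
      · rintro ⟨i, hi, rfl⟩
        exact ⟨i, hi, rfl⟩
      · rintro ⟨i, hi, rfl⟩
        exact ⟨i, hi, rfl⟩
    simp only [sup_adj, fromEdgeSet_adj, Set.mem_ofPred_eq, ← hedge]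
    refine or_congr_right ⟨fun h => h.1, fun h => ⟨h, ?_⟩⟩
    exact (c.adj_of_mem_edges h).ne

namespace IsHalinPresentation

variable (h : IsHalinPresentation G T n f)
include h

theorem le : T ≤ G := fun u v huv => (h.adj_iff u v).mpr (Or.inl huv)

theorem adj_succ {i : ℕ} (hi : i < n) : G.Adj (f i) (f (i + 1)) :=
  (h.adj_iff _ _).mpr (Or.inr ⟨i, hi, rfl⟩)

theorem isLeaf {i : ℕ} (hi : i < n) : IsLeaf T (f i) := (h.isLeaf_iff _).mpr ⟨i, hi, rfl⟩

theorem exists_arc {i j : ℕ} (hij : i ≤ j) (hj : j ≤ n) :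
    ∃ w : G.Walk (f i) (f j), ∀ u ∈ w.support, ∃ k, i ≤ k ∧ k ≤ j ∧ u = f k := by
  induction j, hij using Nat.le_induction with
  | base => exact ⟨.nil, by simp; exact ⟨i, le_rfl, le_rfl, rfl⟩⟩
  | succ j hij ih =>
    obtain ⟨w, hw⟩ := ih (by lia)
    refine ⟨w.concat (h.adj_succ (by lia)), fun u hu => ?_⟩
    simp only [Walk.support_concat, List.mem_append, List.mem_singleton] at hu
    rcases hu with hu | rfl
    · obtain ⟨k, h1, h2, h3⟩ := hw u hu
      exact ⟨k, h1, by lia, h3⟩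
    · exact ⟨j + 1, by lia, le_rfl, rfl⟩

theorem exists_wrapping_arc {i j : ℕ} (hij : i ≤ j) (hj : j < n) :
    ∃ w : G.Walk (f j) (f i), ∀ u ∈ w.support, ∃ k < n, (k ≤ i ∨ j ≤ k) ∧ u = f k := by
  obtain ⟨w, hw⟩ := h.exists_arc hj.le le_rfl
  obtain ⟨w', hw'⟩ := h.exists_arc (Nat.zero_le i) (by lia)
  refine ⟨(w.copy rfl h.closed).append w', fun u hu => ?_⟩
  rw [Walk.mem_support_append_iff, Walk.support_copy] at hu
  rcases hu with hu | hu
  · obtain ⟨k, h1, h2, rfl⟩ := hw u hu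
    rcases h2.lt_or_eq with h2 | rfl
    · exact ⟨k, h2, Or.inr h1, rfl⟩
    · exact ⟨0, by lia, Or.inl (Nat.zero_le i), h.closed⟩
  · obtain ⟨k, h1, h2, rfl⟩ := hw' u hu
    exact ⟨k, by lia, Or.inl h2, rfl⟩

/-- The four indices cut the rim into four arcs, and opposite arcs are disjoint, as `not_crossing`
requires. The two conjuncts are its instances for the two diagonal pairs. -/
theorem not_crossing_of_lt {v : V} {i j k l : ℕ} (hij : i < j) (hjk : j < k) (hkl : k < l)
    (hl : l < n) :
    ¬ (ReachableAvoiding T v (f i) (f k) ∧ Between T (f i) v (f j) ∧ Between T (f i) v (f l)) ∧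
    ¬ (ReachableAvoiding T v (f j) (f l) ∧ Between T (f j) v (f k) ∧
      Between T (f j) v (f i)) := by
  obtain ⟨w₁, h₁⟩ := h.exists_arc hij.le (by lia)
  obtain ⟨w₂, h₂⟩ := h.exists_arc hjk.le (by lia)
  obtain ⟨w₃, h₃⟩ := h.exists_arc hkl.le (by lia)
  obtain ⟨w₄, h₄⟩ := h.exists_wrapping_arc (i := i) (j := l) (by lia) hl
  have l₁ : ∀ x ∈ w₁.support, IsLeaf T x := fun x hx => by
    obtain ⟨m, -, hm, rfl⟩ := h₁ x hx
    exact h.isLeaf (by lia)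
  have l₂ : ∀ x ∈ w₂.support, IsLeaf T x := fun x hx => by
    obtain ⟨m, -, hm, rfl⟩ := h₂ x hx
    exact h.isLeaf (by lia)
  have l₃ : ∀ x ∈ w₃.support, IsLeaf T x := fun x hx => by
    obtain ⟨m, -, hm, rfl⟩ := h₃ x hx
    exact h.isLeaf (by lia)
  have l₄ : ∀ x ∈ w₄.support, IsLeaf T x := fun x hx => by
    obtain ⟨m, hm, -, rfl⟩ := h₄ x hx
    exact h.isLeaf hm
  have d₁ : w₁.support.Disjoint w₃.support := by
    intro x hx hx'
    obtain ⟨m, hm, hm', rfl⟩ := h₁ x hx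
    obtain ⟨m', _, _, he⟩ := h₃ _ hx'
    have := h.injOn _ _ (by lia) (by lia) he
    lia
  have d₂ : w₂.support.Disjoint w₄.support := by
    intro x hx hx'
    obtain ⟨m, hm, hm', rfl⟩ := h₂ x hx
    obtain ⟨m', _, _, he⟩ := h₄ _ hx'
    have := h.injOn _ _ (by lia) (by lia) he
    lia
  constructor
  · rintro ⟨hr, hb, hb'⟩
    exact not_crossing h.planar h.isTree h.le w₁ w₂.reverse w₃ w₄.reverse l₁ (by simpa using l₂)
      l₃ (by simpa using l₄) d₁ (by simpa [List.Disjoint] using d₂) hr hb hb'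
  · rintro ⟨hr, hb, hb'⟩
    exact not_crossing h.planar h.isTree h.le w₂ w₃.reverse w₄ w₁.reverse l₂ (by simpa using l₃)
      l₄ (by simpa using l₁) d₂ (by simpa [List.Disjoint] using fun x a b => d₁ b a) hr hb hb'

/-- If `v` lies on the tree paths between the ends of the edges `p` and `q` of the cycle, then each
component of `T - v` has all its leaves on the same side of these edges. -/
theorem between_of_mem_arc {v : V} {p q a c : ℕ} (hq : q < n)
    (hp' : Between T (f p) v (f (p + 1))) (hq' : Between T (f q) v (f (q + 1)))
    (ha : p < a) (haq : a ≤ q) (hc : c ≤ p ∨ q < c) (hcn : c < n) : Between T (f a) v (f c) := by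
  intro hac
  have haa : ReachableAvoiding T v (f a) (f a) := .refl hac.ne_left
  -- Since `v` separates the ends of each of the two edges, each has an end outside the component of
  -- `f a`. These ends `b` and `d` separate `a` from `c` on the rim.
  obtain ⟨b, hb, hab⟩ : ∃ b, (b = p ∨ b = p + 1) ∧ Between T (f a) v (f b) := by
    by_contra! hcon
    exact hp' ((hcon p (Or.inl rfl)).symm.trans
      (hcon (p + 1) (Or.inr rfl)))
  obtain ⟨d, hd, had⟩ : ∃ d, (d = q ∨ d = q + 1) ∧ Between T (f a) v (f d) := by
    by_contra! hcon
    exact hq' ((hcon q (Or.inl rfl)).symm.trans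
      (hcon (q + 1) (Or.inr rfl)))
  have hba : b ≠ a := by rintro rfl; exact hab haa
  have hbc : b ≠ c := by rintro rfl; exact hab hac
  have hda : d ≠ a := by rintro rfl; exact had haa
  have hdc : d ≠ c := by rintro rfl; exact had hac
  rcases hc with hc | hc
  · have hcb : Between T (f c) v (f b) := fun h' => hab (hac.trans h')
    have hcd : Between T (f c) v (f d) := fun h' => had (hac.trans h')
    by_cases hdn : d < n
    · exact (h.not_crossing_of_lt (i := c) (j := b) (k := a) (l := d) (by lia) (by lia) (by lia)
        hdn).1 ⟨hac.symm, hcb, hcd⟩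
    -- Here `d = q + 1 = n` denotes the leaf `f 0`, so the cyclic order is read from `0`.
    · obtain rfl : d = n := by lia
      rw [h.closed] at hcd
      have hc0 : c ≠ 0 := by
        rintro rfl
        exact hcd (.refl hac.ne_right)
      exact (h.not_crossing_of_lt (i := 0) (j := c) (k := b) (l := a) (by lia) (by lia) (by lia)
        (by lia)).2 ⟨hac.symm, hcb, hcd⟩
  · exact (h.not_crossing_of_lt (i := b) (j := a) (k := d) (l := c) (by lia) (by lia) (by lia)
      hcn).2 ⟨hac, had, hab⟩

end IsHalinPresentation

/-- A cycle does not cross a cut exactly once. -/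
theorem not_isCycle_of_forall_crossing_eq {u s t : V} {Z : G.Walk u u} (hZ : Z.IsCycle) {A : Set V}
    (hst : s(s, t) ∈ Z.edges) (hs : s ∈ A) (ht : t ∉ A)
    (h : ∀ x y, s(x, y) ∈ Z.edges → x ∈ A → y ∉ A → s(x, y) = s(s, t)) : False := by
  have hH : ∀ e ∈ Z.edges, e ∈ (fromEdgeSet {e | e ∈ Z.edges}).edgeSet := by
    intro e he
    rw [edgeSet_fromEdgeSet]
    exact ⟨he, G.not_isDiag_of_mem_edgeSet (Z.edges_subset_edgeSet he)⟩
  -- The rest of the cycle still joins `s` to `t`, so it crosses the cut a second time.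
  obtain ⟨-, ⟨w⟩⟩ := adj_and_reachable_delete_edges_iff_exists_cycle.mpr
    ⟨u, Z.transfer _ hH, hZ.transfer hH, by rwa [Walk.edges_transfer]⟩
  obtain ⟨d, -, hd, hd'⟩ := w.exists_boundary_dart A hs ht
  have hadj := d.adj
  rw [deleteEdges_adj, fromEdgeSet_adj] at hadj
  exact hadj.2 (h _ _ hadj.1.1 hd hd')

namespace IsHalinPresentation

variable (h : IsHalinPresentation G T n f)
include h

theorem isFeedbackVertexSet {X : Set V} {e : V → ℕ}
    (h1 : ∀ v ∈ X, e v < n ∧ Between T (f (e v)) v (f (e v + 1)))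
    (h2 : ∀ i < n, ∃ v ∈ X, Between T (f i) v (f (i + 1))) :
    IsFeedbackVertexSet G (X ∪ (fun v => f (e v)) '' X) := by
  classical
  set S := X ∪ (fun v => f (e v)) '' X with hS
  intro u z hz
  let φ := (Embedding.induce (G := G) Sᶜ).toHom
  let Z := z.map φ
  have hZ : Z.IsCycle := hz.map (Embedding.induce (G := G) Sᶜ).injective
  have hZS : ∀ x ∈ Z.support, x ∉ S := by
    intro x hx
    rw [Walk.support_map, List.mem_map] at hx
    obtain ⟨y, -, rfl⟩ := hx
    exact y.2
  by_cases hTZ : ∀ e ∈ Z.edges, e ∈ T.edgeSet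
  · exact h.isTree.isAcyclic _ (hZ.transfer hTZ)
  push Not at hTZ
  obtain ⟨e₀, he₀, he₀T⟩ := hTZ
  obtain ⟨i, hi, rfl⟩ : ∃ i < n, e₀ = s(f i, f (i + 1)) := by
    induction e₀ with
    | _ x y => exact ((h.adj_iff x y).mp (Z.adj_of_mem_edges he₀)).resolve_left he₀T
  obtain ⟨v, hvX, hv⟩ := h2 i hi
  obtain ⟨hxn, hxv⟩ := h1 v hvX
  have hvZ : ∀ x ∈ Z.support, x ≠ v := fun x hx hxv => hZS x hx (Or.inl (hxv ▸ hvX))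
  have hxZ : ∀ k, s(f k, f (k + 1)) ∈ Z.edges → k ≠ e v := by
    rintro k hk rfl
    exact hZS _ (Z.fst_mem_support_of_mem_edges hk) (Or.inr ⟨v, hvX, rfl⟩)
  have hix := hxZ i he₀
  obtain ⟨p, q, hpq, hqn, hp', hq', hpqi, hpqk⟩ : ∃ p q, p < q ∧ q < n ∧
      Between T (f p) v (f (p + 1)) ∧ Between T (f q) v (f (q + 1)) ∧ (i = p ∨ i = q) ∧
      ∀ k, k ≠ e v → k = p ∨ k = q → k = i := by
    rcases hix.lt_or_gt with hlt | hlt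
    · exact ⟨i, e v, hlt, hxn, hv, hxv, Or.inl rfl, by lia⟩
    · exact ⟨e v, i, hlt, hi, hxv, hv, Or.inr rfl, by lia⟩
  -- The cut: the union of the components of `T - v` that have a leaf on the arc from `p + 1` to
  -- `q`. By `between_of_mem_arc`, the only rim edges avoiding `v` that can leave it are those at
  -- `p` and `q`.
  let A : Set V := {w | ∃ j, p < j ∧ j ≤ q ∧ ReachableAvoiding T v (f j) w}
  have hA : ∀ m ≤ n, f m ≠ v → (f m ∈ A ↔ p < m ∧ m ≤ q) := by
    intro m hm hmv
    refine ⟨fun ⟨j, hj, hj', hr⟩ => ?_, fun hm => ⟨m, hm.1, hm.2, .refl hmv⟩⟩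
    by_contra hcon
    rcases hm.lt_or_eq with hm | rfl
    · exact h.between_of_mem_arc hqn hp' hq' hj hj' (by lia) hm hr
    · rw [h.closed] at hr
      exact h.between_of_mem_arc hqn hp' hq' hj hj' (Or.inl (Nat.zero_le p)) (by lia) hr
  have hcross : ∀ x y, s(x, y) ∈ Z.edges → x ∈ A → y ∉ A → s(x, y) = s(f i, f (i + 1)) := by
    rintro x y hxy hx hy
    have hxv' := hvZ x (Z.fst_mem_support_of_mem_edges hxy)
    have hyv' := hvZ y (Z.snd_mem_support_of_mem_edges hxy)
    rcases (h.adj_iff x y).mp (Z.adj_of_mem_edges hxy) with hT | ⟨k, hk, hek⟩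
    · obtain ⟨j, hj, hj', hr⟩ := hx
      exact absurd ⟨j, hj, hj', hr.trans (.of_adj hT hxv' hyv')⟩ hy
    · rw [hek] at hxy ⊢
      have hki : k = i := by
        refine hpqk k (hxZ k hxy) ?_
        rcases Sym2.eq_iff.mp hek with ⟨rfl, rfl⟩ | ⟨rfl, rfl⟩
        · rw [hA k hk.le hxv'] at hx
          rw [hA (k + 1) hk hyv'] at hy
          lia
        · rw [hA k hk.le hyv'] at hy
          rw [hA (k + 1) hk hxv'] at hx
          lia
      rw [hki]
  have hiv := hvZ _ (Z.fst_mem_support_of_mem_edges he₀)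
  have hiv' := hvZ _ (Z.snd_mem_support_of_mem_edges he₀)
  rcases hpqi with rfl | rfl
  · refine not_isCycle_of_forall_crossing_eq hZ (A := A) (s := f (i + 1)) (t := f i)
      (by rwa [Sym2.eq_swap]) ?_ ?_ (by rwa [Sym2.eq_swap (a := f (i + 1))])
    · rw [hA _ hi hiv']; lia
    · rw [hA _ hi.le hiv]; lia
  · refine not_isCycle_of_forall_crossing_eq hZ (A := A) he₀ ?_ ?_ hcross
    · rw [hA _ hi.le hiv]; lia
    · rw [hA _ hi hiv']; lia

/-- Two adjacent leaves would be the whole tree, but there are at least three leaves. This makes the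
fundamental cycle of a rim edge a genuine cycle. -/
theorem not_adj_succ {i : ℕ} (hi : i < n) : ¬ T.Adj (f i) (f (i + 1)) := by
  intro hadj
  have h3 := h.three_le
  have hl : IsLeaf T (f (i + 1)) := by
    rcases (show i + 1 ≤ n from hi).lt_or_eq with h' | h'
    · exact h.isLeaf h'
    · rw [h', h.closed]
      exact h.isLeaf (by lia)
  obtain ⟨k, hk, hki, hki'⟩ : ∃ k < n, f k ≠ f i ∧ f k ≠ f (i + 1) := by
    rcases (show i + 1 ≤ n from hi).lt_or_eq with h' | h'
    · obtain ⟨k, hk, h1, h2⟩ : ∃ k < n, k ≠ i ∧ k ≠ i + 1 := by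
        by_contra! hcon
        have := hcon 0 (by lia)
        have := hcon 1 (by lia)
        have := hcon 2 (by lia)
        lia
      exact ⟨k, hk, fun he => h1 (h.injOn _ _ hk hi he), fun he => h2 (h.injOn _ _ hk h' he)⟩
    · rw [h', h.closed]
      refine ⟨1, by lia, fun he => ?_, fun he => ?_⟩
      · have := h.injOn _ _ (by lia) hi he
        lia
      · have := h.injOn _ _ (by lia) (by lia) he
        lia
  obtain ⟨u, p, q, hp, hu, -, hpq⟩ := exists_adj_reachableAvoiding h.isTree.connected hki
  obtain rfl := (h.isLeaf hi).unique hu hadj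
  rcases hl.eq_or_eq_of_mem_support h.isTree hp ((hpq _).mpr (Or.inr q.start_mem_support)) with
    h' | h'
  · exact hadj.ne h'.symm
  · exact hki' h'.symm

theorem exists_cycleSubgraph {i : ℕ} (hi : i < n) :
    ∃ H : G.Subgraph, IsCycleSubgraph H ∧ H.verts.Nonempty ∧
      ∀ w ∈ H.verts, Between T (f i) w (f (i + 1)) := by
  classical
  obtain ⟨p, hp, -⟩ := h.isTree.existsUnique_path (f (i + 1)) (f i)
  have hc : (Walk.cons (h.adj_succ hi) (p.mapLe h.le)).IsCycle := by
    rw [Walk.cons_isCycle_iff]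
    refine ⟨(Walk.isPath_mapLe h.le).mpr hp, fun he => h.not_adj_succ hi ?_⟩
    rw [Walk.edges_mapLe_eq_edges] at he
    exact p.adj_of_mem_edges he
  refine ⟨_, ⟨_, _, hc, rfl⟩, ⟨f i, by simp⟩, fun w hw hr => ?_⟩
  rw [Walk.mem_verts_toSubgraph, Walk.support_cons, Walk.support_mapLe_eq_support,
    List.mem_cons] at hw
  have hw' : w ∈ p.support := by
    rcases hw with rfl | hw
    · exact p.end_mem_support
    · exact hw
  exact not_reachableAvoiding_of_mem_support h.isTree.isAcyclic hp hw' hr.symm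

end IsHalinPresentation

theorem IsHalin.fvs_le_two_mul_cp [Finite V] (hG : IsHalin G) : fvs G ≤ 2 * cp G := by
  obtain ⟨T, n, f, h⟩ := hG.exists_presentation
  obtain ⟨X, e, h1, h2, h3⟩ := exists_hitting_set_of_paths h.isTree f (fun i => f (i + 1))
    (Finset.range n)
  simp only [Finset.mem_range] at h1 h3
  choose! H hH hne hbet using fun i (hi : i < n) => h.exists_cycleSubgraph hi
  have hdisj : ∀ v ∈ X, ∀ v' ∈ X, v ≠ v' → Disjoint (H (e v)).verts (H (e v')).verts := by
    intro v hv v' hv' hvv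
    rw [Set.disjoint_left]
    intro w hw hw'
    exact h2 v hv v' hv' hvv w ⟨hbet _ (h1 v hv).1 w hw, hbet _ (h1 v' hv').1 w hw'⟩
  have hinj : Set.InjOn (fun v => H (e v)) X := by
    intro v hv v' hv' hvv
    by_contra hcon
    have hd := hdisj v hv v' hv' hcon
    simp only at hvv
    rw [hvv, disjoint_self] at hd
    exact (hne _ (h1 v' hv').1).ne_empty hd
  have hpack : IsCyclePacking G ((fun v => H (e v)) '' X) := by
    constructor
    · rintro _ ⟨v, hv, rfl⟩
      exact hH _ (h1 v hv).1
    · rintro _ ⟨v, hv, rfl⟩ _ ⟨v', hv', rfl⟩ hvv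
      exact hdisj v hv v' hv' fun he => hvv (he ▸ rfl)
  calc fvs G ≤ (X ∪ (fun v => f (e v)) '' X).encard :=
        iInf₂_le _ (h.isFeedbackVertexSet h1 h3)
    _ ≤ X.encard + ((fun v => f (e v)) '' X).encard := Set.encard_union_le _ _
    _ ≤ X.encard + X.encard := by grw [Set.encard_image_le]
    _ = 2 * ((fun v => H (e v)) '' X).encard := by rw [hinj.encard_image, two_mul]
    _ ≤ 2 * cp G := by
        gcongr
        exact le_iSup₂ (f := fun (P : Set G.Subgraph) (_ : IsCyclePacking G P) => P.encard) _ hpack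

end

end JonesHalin

theorem mainTheorem2 {V : Type*} [Finite V] (G : SimpleGraph V) (hG : JonesHalin.IsHalin G) :
    JonesHalin.fvs G ≤ 2 * JonesHalin.cp G :=
  hG.fvs_le_two_mul_cp
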